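/- Let $K$ be a number field of degree $d=[K:\mathbb{Q}]$. Write $N\mathfrak{m}$ for the norm of a nonzero ideal $\mathfrak{m}$ of the ring of integers $\mathcal{O}_K$, and let $c_K=\lim_{x\to\infty}\frac1x\#\{\mathfrak{m}\neq 0: N\mathfrak{m}\leq x\}$ be the ideal density of $\mathcal{O}_K$. There is a constant $C$ depending only on $K$ such that, for every continuously differentiable $g:[1,\infty)\to\mathbb{C}$ and every real $x\geq 1$, $$\sum_{\mathfrak{m}\neq 0,\ N\mathfrak{m}\leq x} g(N\mathfrak{m}) = c_K\int_1^x g(t)\,dt + c_K\,g(1) + E,$$ where $$|E|\leq C\Big(|g(x)|\,x^{1-1/d}+\int_1^x |g'(t)|\,t^{1-1/d}\,dt\Big).$$ -/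

import Mathlib

open scoped NumberField Topology

/-- The finite set of nonzero ideals `𝔪` of `𝓞 K` with `N(𝔪) ≤ x`. -/
noncomputable def idealsUpTo (K : Type*) [Field K] [NumberField K] (x : ℝ) :
    Finset (Ideal (𝓞 K)) :=
  Set.Finite.toFinset
    (s := {m : Ideal (𝓞 K) | m ≠ ⊥ ∧ (Ideal.absNorm m : ℝ) ≤ x})
    ((Ideal.finite_setOfPred_absNorm_le ⌊x⌋₊).subset fun _ hm => Nat.le_floor hm.2)

theorem mem_idealsUpTo {K : Type*} [Field K] [NumberField K] {x : ℝ} {m : Ideal (𝓞 K)} :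
    m ∈ idealsUpTo K x ↔ m ≠ ⊥ ∧ (Ideal.absNorm m : ℝ) ≤ x := by
  simp [idealsUpTo]

/-- The ideal density `c_K = lim_{x → ∞} #{𝔪 ≠ 0 : N(𝔪) ≤ x} / x`; the limit exists by
`tendsto_idealDensity`. -/
noncomputable def idealDensity (K : Type*) [Field K] [NumberField K] : ℝ :=
  Filter.limUnder Filter.atTop (fun x : ℝ => ((idealsUpTo K x).card : ℝ) / x)

theorem tendsto_dedekindZeta_residue (K : Type*) [Field K] [NumberField K] :
    Filter.Tendsto (fun x : ℝ => ((idealsUpTo K x).card : ℝ) / x) Filter.atTop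
      (𝓝 (NumberField.dedekindZeta_residue K)) := by
  rw [NumberField.dedekindZeta_residue_def]
  have h := NumberField.Ideal.tendsto_norm_le_div_atTop₀ K
  refine h.congr fun x => ?_
  congr 2
  rw [← Nat.card_eq_finsetCard]
  refine Nat.card_congr
    { toFun := fun I => ⟨I.1.1, mem_idealsUpTo.2 ⟨nonZeroDivisors.ne_zero I.1.2, I.2⟩⟩
      invFun := fun I => ⟨⟨I.1, mem_nonZeroDivisors_of_ne_zero (mem_idealsUpTo.1 I.2).1⟩,
        (mem_idealsUpTo.1 I.2).2⟩
      left_inv := fun _ => rfl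
      right_inv := fun _ => rfl }

theorem idealDensity_eq_residue (K : Type*) [Field K] [NumberField K] :
    idealDensity K = NumberField.dedekindZeta_residue K :=
  (tendsto_dedekindZeta_residue K).limUnder_eq

theorem tendsto_idealDensity (K : Type*) [Field K] [NumberField K] :
    Filter.Tendsto (fun x : ℝ => ((idealsUpTo K x).card : ℝ) / x) Filter.atTop
      (𝓝 (idealDensity K)) := by
  rw [idealDensity_eq_residue]
  exact tendsto_dedekindZeta_residue K

theorem idealDensity_pos (K : Type*) [Field K] [NumberField K] : 0 < idealDensity K := by
  rw [idealDensity_eq_residue]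
  exact NumberField.dedekindZeta_residue_pos K

/-! Partial summation reduces the claim to the ideal count: `c_K * x + O(x ^ (1 - 1 / d))` nonzero
ideals have norm at most `x`. Multiplying by a fixed ideal turns each ideal class into principal
ideals, whose generators, up to torsion, are the points of a lattice in a cone. Those of norm at
most `s` fill the dilate of `normLeOne K` by `s ^ (1 / d)`. Lattice points in a region are counted
by its volume, up to the number of balls of fixed radius covering its frontier
(`ZLattice.exists_abs_card_mul_covolume_sub_le`). The frontier of `normLeOne K` lies in finitely
many Lipschitz images of the boundary of a `d`-cube, so its dilate by `r` needs `O(r ^ (d - 1))`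
balls. This saves the factor `s ^ (1 / d)`. -/

/-! ### Lattice points and coverings of the frontier -/

section LatticePoints

open MeasureTheory Module

theorem IsPreconnected.inter_frontier_nonempty_of_mem_of_notMem {X : Type*} [TopologicalSpace X]
    {s t : Set X} (hs : IsPreconnected s) {x y : X} (hx : x ∈ s) (hy : y ∈ s) (hxt : x ∈ t)
    (hyt : y ∉ t) : (s ∩ frontier t).Nonempty := by
  by_contra h
  rw [Set.not_nonempty_iff_eq_empty, Set.eq_empty_iff_forall_notMem] at h
  have hcover : ∀ z ∈ s, z ∈ interior t ∨ z ∈ interior tᶜ := fun z hz ↦ by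
    by_contra! hz'
    refine h z ⟨hz, ?_, hz'.1⟩
    have := hz'.2
    rwa [interior_compl, Set.notMem_compl_iff] at this
  obtain ⟨z, -, hz₁, hz₂⟩ := hs _ _ isOpen_interior isOpen_interior (fun z hz ↦ hcover z hz)
    ⟨x, hx, (hcover x hx).resolve_right fun h' ↦ interior_subset h' hxt⟩
    ⟨y, hy, (hcover y hy).resolve_left fun h' ↦ hyt (interior_subset h')⟩
  exact interior_subset hz₂ (interior_subset hz₁)

/-- The segment from `x` to `y` is connected, hence crosses the frontier. -/
theorem exists_mem_frontier_dist_le {E : Type*} [NormedAddCommGroup E] [NormedSpace ℝ E]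
    {S : Set E} {x y : E} (hx : x ∈ S) (hy : y ∉ S) :
    ∃ z ∈ frontier S, dist x z ≤ dist x y ∧ dist y z ≤ dist x y := by
  obtain ⟨z, hz, hzS⟩ := (convex_segment x y).isPreconnected.inter_frontier_nonempty_of_mem_of_notMem
    (left_mem_segment ℝ x y) (right_mem_segment ℝ x y) hx hy
  have h := dist_add_dist_of_mem_segment hz
  rw [dist_comm z y] at h
  exact ⟨z, hzS, by linarith [dist_nonneg (x := y) (y := z)],
    by linarith [dist_nonneg (x := x) (y := z)]⟩

/-- The number of points of a lattice in a bounded set differs from its normalized volume by at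
most the number of balls of fixed radius needed to cover the frontier of the set, up to a constant
depending on the lattice and the radius. -/
theorem ZLattice.exists_abs_card_mul_covolume_sub_le {E : Type*} [NormedAddCommGroup E]
    [NormedSpace ℝ E] [FiniteDimensional ℝ E] [MeasurableSpace E] [BorelSpace E]
    (L : Submodule ℤ E) [DiscreteTopology L] [IsZLattice ℝ L]
    (μ : Measure E) [μ.IsAddHaarMeasure] :
    ∃ δ : ℝ, ∀ (S : Set E), MeasurableSet S → Bornology.IsBounded S → ∀ (T : Finset E) (R : ℝ),
      (∀ y ∈ frontier S, ∃ t ∈ T, dist y t ≤ R) →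
      |Nat.card (S ∩ L : Set E) * ZLattice.covolume L μ - μ.real S|
        ≤ T.card * μ.real (Metric.closedBall 0 (δ + R)) := by
  classical
  let b := Free.chooseBasis ℤ L
  let B := b.ofZLatticeBasis ℝ L
  set F := ZSpan.fundamentalDomain B
  have hFm : MeasurableSet F := ZSpan.fundamentalDomain_measurableSet _
  have hFb : Bornology.IsBounded F := ZSpan.fundamentalDomain_isBounded _
  have hspan : Submodule.span ℤ (Set.range B) = L := b.ofZLatticeBasis_span ℝ L
  have huniq : ∀ x : E, ∃! v : L, v +ᵥ x ∈ F := fun x ↦ by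
    have := ZSpan.exist_unique_vadd_mem_fundamentalDomain B x
    rwa [hspan] at this
  obtain ⟨δ, hδ⟩ := hFb.exists_norm_le
  refine ⟨δ, fun S hSm hSb T R hT ↦ ?_⟩
  have hfin : (S ∩ L : Set E).Finite := by
    have := ZSpan.setFinite_inter B hSb
    rwa [hspan] at this
  -- `U` is the union of the cells attached to the lattice points of `S`; its volume is their number
  -- times the covolume.
  let U : Set E := ⋃ l ∈ hfin.toFinset, (fun f ↦ l + f) '' F
  have hUm : MeasurableSet U := Finset.measurableSet_biUnion _ fun l _ ↦
    (MeasurableEquiv.addLeft l).measurableSet_image.mpr hFm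
  have hFfin : μ F ≠ ⊤ := hFb.measure_lt_top.ne
  have hμl : ∀ l : E, μ ((fun f ↦ l + f) '' F) = μ F := fun l ↦ by
    rw [Set.image_add_left, measure_preimage_add]
  have hU : μ.real U = Nat.card (S ∩ L : Set E) * ZLattice.covolume L μ := by
    rw [measureReal_biUnion_finset (h := fun l _ ↦ by rw [hμl]; exact hFfin)]
    · simp_rw [measureReal_def, hμl]
      rw [Finset.sum_const, nsmul_eq_mul, ZLattice.covolume_eq_measure_fundamentalDomain L μ
        (ZLattice.isAddFundamentalDomain b μ), measureReal_def, Nat.card_eq_card_finite_toFinset hfin]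
    · rintro l hl m hm hlm
      rw [Function.onFun, Set.disjoint_left]
      rintro _ ⟨f, hf, rfl⟩ ⟨f', hf', h⟩
      simp only [Set.Finite.coe_toFinset] at hl hm h
      have := (huniq (l + f)).unique (y₁ := -⟨l, hl.2⟩) (y₂ := -⟨m, hm.2⟩)
        (by simpa [Submodule.vadd_def] using hf) (by rw [← h]; simpa [Submodule.vadd_def] using hf')
      exact hlm (by simpa using this)
    · exact fun l _ ↦ (MeasurableEquiv.addLeft l).measurableSet_image.mpr hFm
  have hUfin : μ U ≠ ⊤ := by
    refine ((measure_biUnion_finset_le _ _).trans_lt ?_).ne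
    simp_rw [hμl]
    exact ENNReal.sum_lt_top.mpr fun _ _ ↦ hFfin.lt_top
  have hSfin : μ S ≠ ⊤ := hSb.measure_lt_top.ne
  -- A point of the symmetric difference and the lattice point of its cell lie on opposite sides of
  -- `S`, at distance at most `δ`, so the frontier passes within `δ` of it.
  have hsub : symmDiff U S ⊆ ⋃ t ∈ T, Metric.closedBall t (δ + R) := by
    intro x hx
    suffices h : ∃ z ∈ frontier S, dist x z ≤ δ by
      obtain ⟨z, hz, hxz⟩ := h
      obtain ⟨t, ht, hzt⟩ := hT z hz
      exact Set.mem_biUnion ht (Metric.mem_closedBall.mpr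
        ((dist_triangle x z t).trans (add_le_add hxz hzt)))
    rcases hx with ⟨hxU, hxS⟩ | ⟨hxS, hxU⟩
    · simp only [U, Set.mem_iUnion, Set.Finite.mem_toFinset] at hxU
      obtain ⟨l, hl, f, hf, rfl⟩ := hxU
      obtain ⟨z, hz, -, h⟩ := exists_mem_frontier_dist_le hl.1 hxS
      exact ⟨z, hz, h.trans (by simpa using hδ f hf)⟩
    · obtain ⟨v, hv, -⟩ := huniq x
      have hvS : -(v : E) ∉ S := fun h ↦ hxU <| by
        simp only [U, Set.mem_iUnion, Set.Finite.mem_toFinset]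
        exact ⟨-v, ⟨h, by simp⟩, _, hv, by simp [Submodule.vadd_def]⟩
      obtain ⟨z, hz, h, -⟩ := exists_mem_frontier_dist_le hxS hvS
      refine ⟨z, hz, h.trans ?_⟩
      have := hδ _ hv
      rwa [Submodule.vadd_def, vadd_eq_add, add_comm, ← sub_neg_eq_add, ← dist_eq_norm] at this
  have hball : μ (⋃ t ∈ T, Metric.closedBall t (δ + R)) ≠ ⊤ :=
    ((measure_biUnion_finset_le _ _).trans_lt
      (ENNReal.sum_lt_top.mpr fun _ _ ↦ measure_closedBall_lt_top)).ne
  calc |Nat.card (S ∩ L : Set E) * ZLattice.covolume L μ - μ.real S|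
      = |μ.real U - μ.real S| := by rw [hU]
    _ ≤ μ.real (symmDiff U S) := by
        exact abs_measureReal_sub_le_measureReal_symmDiff' hUm.nullMeasurableSet
          hSm.nullMeasurableSet hUfin hSfin
    _ ≤ μ.real (⋃ t ∈ T, Metric.closedBall t (δ + R)) := measureReal_mono hsub hball
    _ ≤ ∑ t ∈ T, μ.real (Metric.closedBall t (δ + R)) := measureReal_biUnion_finset_le _ _
    _ = T.card * μ.real (Metric.closedBall 0 (δ + R)) := by
        simp_rw [measureReal_def, Measure.addHaar_closedBall_center, Finset.sum_const, nsmul_eq_mul]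

open Pointwise in
/-- If a set is contained in a finite union of Lipschitz images of the boundary of the unit cube of
dimension `card ι`, then its dilation by `r` is covered by `O(r ^ (card ι - 1))` balls of a fixed
radius. -/
theorem exists_finset_cover_smul_of_subset_cube_boundary {E ι σ : Type*} [NormedAddCommGroup E]
    [NormedSpace ℝ E] [Fintype ι] [Fintype σ] (Φ : σ → (ι → ℝ) → E)
    (hΦ : ∀ s, ∃ M, LipschitzOnWith M (Φ s) (Set.Icc 0 1)) {B : Set E}
    (hB : ∀ x ∈ B, ∃ s, ∃ p ∈ Set.Icc (0 : ι → ℝ) 1, (∃ j, p j = 0 ∨ p j = 1) ∧ Φ s p = x) :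
    ∃ C R : ℝ, ∀ r : ℝ, 1 ≤ r → ∃ T : Finset E, T.card ≤ C * r ^ (Fintype.card ι - 1) ∧
      ∀ y ∈ r • B, ∃ t ∈ T, dist y t ≤ R := by
  classical
  choose M hM using hΦ
  obtain ⟨N, hN⟩ : ∃ N : ℝ, ∀ s, M s ≤ N := by
    obtain ⟨N, hN⟩ := (Set.finite_range M).bddAbove
    exact ⟨N, fun s ↦ NNReal.coe_le_coe.mpr (hN ⟨s, rfl⟩)⟩
  refine ⟨Fintype.card σ * (Fintype.card ι * 2 * 3 ^ (Fintype.card ι - 1)), N, fun r hr ↦ ?_⟩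
  set n := ⌈r⌉₊
  have hn : r ≤ n := Nat.le_ceil r
  have hn0 : (0 : ℝ) < n := by linarith
  -- Grid of mesh `1 / n` on the faces: `j` and the Boolean choose a face, the indices a point on
  -- it. Since `r ≤ n`, dilation by `r` keeps the error below the Lipschitz constant.
  let q : (Σ j : ι, Bool × ({i // i ≠ j} → Fin (n + 1))) → ι → ℝ := fun a i ↦
    if h : i ≠ a.1 then ((a.2.2 ⟨i, h⟩ : ℕ) : ℝ) / n else if a.2.1 then 1 else 0
  let A := σ × (Σ j : ι, Bool × ({i // i ≠ j} → Fin (n + 1)))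
  refine ⟨Finset.univ.image fun a : A ↦ r • Φ a.1 (q a.2), ?_, ?_⟩
  · have hcard : Fintype.card A
        = Fintype.card σ * (Fintype.card ι * (2 * (n + 1) ^ (Fintype.card ι - 1))) := by
      simp [A, Fintype.card_subtype_compl]
    have hn1 : (n : ℝ) + 1 ≤ 3 * r := by linarith [Nat.ceil_lt_add_one (show 0 ≤ r by linarith)]
    calc ((Finset.univ.image fun a : A ↦ r • Φ a.1 (q a.2)).card : ℝ)
        ≤ Fintype.card A := by exact_mod_cast Finset.card_image_le
      _ = Fintype.card σ * (Fintype.card ι * (2 * ((n : ℝ) + 1) ^ (Fintype.card ι - 1))) := by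
          rw [hcard]; push_cast; rfl
      _ ≤ Fintype.card σ * (Fintype.card ι * (2 * (3 * r) ^ (Fintype.card ι - 1))) := by gcongr
      _ = _ := by rw [mul_pow]; ring
  · rintro _ ⟨x, hx, rfl⟩
    obtain ⟨s, p, hp, ⟨j, hj⟩, rfl⟩ := hB x hx
    have hfl : ∀ i, ⌊p i * n⌋₊ ≤ n := fun i ↦ Nat.floor_le_of_le
      (by nlinarith [hp.2 i, Pi.one_apply (M := fun _ : ι ↦ ℝ) i])
    let a : Σ j : ι, Bool × ({i // i ≠ j} → Fin (n + 1)) :=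
      ⟨j, decide (p j = 1), fun i ↦ ⟨⌊p i * n⌋₊, Nat.lt_succ_of_le (hfl i)⟩⟩
    have hqa : ∀ i, 0 ≤ q a i ∧ q a i ≤ 1 ∧ |p i - q a i| ≤ 1 / n := fun i ↦ by
      by_cases h : i = j
      · subst h
        rcases hj with hj | hj <;> simp [q, a, hj]
      · have hq : q a i = (⌊p i * n⌋₊ : ℝ) / n := by simp [q, a, h]
        have hpi : 0 ≤ p i * n := mul_nonneg (hp.1 i) hn0.le
        refine ⟨by rw [hq]; positivity, ?_, ?_⟩
        · rw [hq, div_le_one hn0]; exact_mod_cast hfl i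
        · have h₁ := Nat.floor_le hpi
          have h₂ := Nat.lt_floor_add_one (p i * n)
          rw [hq, show p i - (⌊p i * n⌋₊ : ℝ) / n = (p i * n - ⌊p i * n⌋₊) / n by field_simp,
            abs_div, abs_of_pos hn0, abs_of_nonneg (by linarith)]
          gcongr
          linarith
    refine ⟨r • Φ s (q a), Finset.mem_image.mpr ⟨(s, a), Finset.mem_univ _, rfl⟩, ?_⟩
    have hd : dist p (q a) ≤ 1 / n := (dist_pi_le_iff (by positivity)).mpr fun i ↦ by
      rw [Real.dist_eq]; exact (hqa i).2.2
    have hΦd := (hM s).dist_le_mul p hp (q a) ⟨fun i ↦ (hqa i).1, fun i ↦ (hqa i).2.1⟩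
    rw [dist_smul₀, Real.norm_of_nonneg (by linarith)]
    have hM0 : (0 : ℝ) ≤ M s := (M s).2
    calc r * dist (Φ s p) (Φ s (q a)) ≤ n * (M s * (1 / n)) := by
          gcongr
          exact hΦd.trans (by gcongr)
      _ = M s := by field_simp
      _ ≤ N := hN s

end LatticePoints

/-! ### Parametrization of the frontier of `normLeOne K` -/

section Frontier

open NumberField NumberField.InfinitePlace NumberField.mixedEmbedding
  NumberField.mixedEmbedding.fundamentalCone NumberField.Units.dirichletUnitTheorem

variable {K : Type*} [Field K] [NumberField K]

theorem contDiff_expMapBasis : ContDiff ℝ 1 (expMapBasis : realSpace K → realSpace K) := by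
  refine contDiff_pi.mpr fun w ↦ ?_
  have h : ContDiff ℝ 1 fun x : realSpace K ↦ (completeBasis K).equivFunL.symm x w :=
    (contDiff_apply ℝ ℝ w).comp (completeBasis K).equivFunL.symm.contDiff
  exact Real.contDiff_exp.comp (contDiff_const.mul h)

open scoped Classical in
/-- The absolute values at the infinite places of the point of parameter `p`. -/
noncomputable def normParam (p : InfinitePlace K ⊕ {w : InfinitePlace K // IsComplex w} → ℝ) :
    realSpace K :=
  p (.inl w₀) • expMapBasis (fun w ↦ if w = w₀ then 0 else p (.inl w))

/-- The points with absolute values given by `normParam`, signs `s` at the real places, and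
arguments given by the last coordinates of the parameter. -/
noncomputable def mixedSpaceParam (s : {w : InfinitePlace K // IsReal w} → SignType)
    (p : InfinitePlace K ⊕ {w : InfinitePlace K // IsComplex w} → ℝ) : mixedSpace K :=
  (fun w ↦ s w * normParam p w,
    fun w ↦ (normParam p w : ℂ) *
      Complex.exp (((2 * Real.pi * p (.inr w) - Real.pi : ℝ) : ℂ) * Complex.I))

open scoped Classical in
theorem contDiff_normParam : ContDiff ℝ 1 (normParam (K := K)) := by
  refine (contDiff_apply ℝ ℝ _).smul (contDiff_expMapBasis.comp (contDiff_pi.mpr fun w ↦ ?_))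
  split_ifs
  · exact contDiff_const
  · exact contDiff_apply ℝ ℝ _

open scoped Classical in
theorem contDiff_mixedSpaceParam (s : {w : InfinitePlace K // IsReal w} → SignType) :
    ContDiff ℝ 1 (mixedSpaceParam s) := by
  have hρ : ∀ w : InfinitePlace K, ContDiff ℝ 1 fun p ↦ normParam p w := fun w ↦
    (contDiff_apply ℝ ℝ w).comp contDiff_normParam
  refine ContDiff.prodMk (contDiff_pi.mpr fun w ↦ contDiff_const.mul (hρ w))
    (contDiff_pi.mpr fun w ↦ ?_)
  refine (Complex.ofRealCLM.contDiff.comp (hρ w)).mul (Complex.contDiff_exp.comp ?_)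
  refine (Complex.ofRealCLM.contDiff.comp ?_).mul contDiff_const
  exact (contDiff_const.mul (contDiff_apply ℝ ℝ _)).sub contDiff_const

/-- Polar coordinates: `s` holds the signs, which may be zero, and `θ` the arguments rescaled to
`[0, 1]`. `normParam` ignores the angular coordinates, hence the `0`. -/
theorem exists_mixedSpaceParam_eq {x : mixedSpace K}
    {p : InfinitePlace K → ℝ} (hx : normAtAllPlaces x = normParam (Sum.elim p 0)) :
    ∃ s, ∃ θ : {w : InfinitePlace K // IsComplex w} → ℝ, (∀ w, θ w ∈ Set.Icc 0 1) ∧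
      mixedSpaceParam s (Sum.elim p θ) = x := by
  have hpi := Real.pi_pos
  refine ⟨fun w ↦ SignType.sign (x.1 w), fun w ↦ ((x.2 w).arg / Real.pi + 1) / 2, fun w ↦ ?_, ?_⟩
  · have h₁ : -1 ≤ (x.2 w).arg / Real.pi := by
      rw [le_div_iff₀ hpi]; linarith [Complex.neg_pi_lt_arg (x.2 w)]
    have h₂ : (x.2 w).arg / Real.pi ≤ 1 := by
      rw [div_le_one hpi]; exact Complex.arg_le_pi _
    constructor <;> linarith
  · have hρ : ∀ θ, normParam (Sum.elim p θ) = normAtAllPlaces x := fun θ ↦ by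
      rw [hx]; rfl
    refine Prod.ext (funext fun w ↦ ?_) (funext fun w ↦ ?_)
    · simp only [mixedSpaceParam, hρ, normAtAllPlaces_apply, normAtPlace_apply_of_isReal w.2,
        Real.norm_eq_abs, sign_mul_abs]
    · simp only [mixedSpaceParam, hρ, normAtAllPlaces_apply, normAtPlace_apply_of_isComplex w.2,
        Sum.elim_inr]
      rw [show 2 * Real.pi * (((x.2 w).arg / Real.pi + 1) / 2) - Real.pi = (x.2 w).arg by
        field_simp; ring, Complex.norm_mul_exp_arg_mul_I]

/-- The frontier of `normLeOne K` is parametrized by the boundary of the unit cube. -/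
theorem exists_mixedSpaceParam_of_mem_frontier_normLeOne {x : mixedSpace K}
    (hx : x ∈ frontier (normLeOne K)) :
    ∃ s, ∃ p ∈ Set.Icc (0 : InfinitePlace K ⊕ {w : InfinitePlace K // IsComplex w} → ℝ) 1,
      (∃ j, p j = 0 ∨ p j = 1) ∧ mixedSpaceParam s p = x := by
  classical
  obtain ⟨c, hc, _, ⟨y, hy, rfl⟩, hxc⟩ := closure_normLeOne_subset K hx.1
  replace hy : ∀ w, y w ∈ if w = w₀ then ({0} : Set ℝ) else Set.Icc 0 1 := fun w ↦ hy w trivial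
  -- The coordinate at `w₀` becomes the scaling factor `c`, the exponential of a logarithmic
  -- coordinate unbounded below; the parameters thus fill a cube.
  let p : InfinitePlace K → ℝ := fun w ↦ if w = w₀ then c else y w
  have hy' : (fun w ↦ if w = w₀ then 0 else p w) = y := by
    ext w
    by_cases h : w = w₀
    · subst h; simpa [eq_comm] using hy w₀
    · simp [p, h]
  have hpw : p w₀ = c := by simp [p]
  have hp : ∀ w, p w ∈ Set.Icc (0 : ℝ) 1 := fun w ↦ by
    by_cases h : w = w₀
    · subst h; rwa [hpw]
    · simpa [p, h] using hy w
  have hnorm : normAtAllPlaces x = normParam (Sum.elim p 0) := by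
    simp only [normParam, Sum.elim_inl, hpw]
    rw [hy', ← hxc]
  obtain ⟨s, θ, hθ, hxs⟩ := exists_mixedSpaceParam_eq hnorm
  refine ⟨s, Sum.elim p θ, ⟨?_, ?_⟩, ?_, hxs⟩
  · rintro (w | w)
    exacts [(hp w).1, (hθ w).1]
  · rintro (w | w)
    exacts [(hp w).2, (hθ w).2]
  -- If every `p w` lies strictly between `0` and `1`, then `x` is an interior point; the angles
  -- play no role.
  · by_contra! h
    have hp' : ∀ w, p w ∈ Set.Ioo (0 : ℝ) 1 := fun w ↦
      ⟨lt_of_le_of_ne (hp w).1 (h (.inl w)).1.symm, lt_of_le_of_ne (hp w).2 (h (.inl w)).2⟩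
    refine hx.2 (subset_interior_normLeOne K ?_)
    refine ⟨fun w ↦ if w = w₀ then Real.log c else y w, ?_, ?_⟩
    · rw [interior_paramSet, Set.mem_univ_pi]
      intro w
      have := hp' w
      by_cases hw : w = w₀
      · subst hw
        rw [hpw] at this
        simpa using Real.log_neg this.1 this.2
      · simpa [p, hw] using this
    · have hc' : 0 < c := hpw ▸ (hp' w₀).1
      rw [← hxc, expMapBasis_apply'', if_pos rfl, Real.exp_log hc', ← hy']
      congr 2
      ext w
      by_cases hw : w = w₀ <;> simp [hw]

open scoped Classical in
-- The cube has dimension `(r₁ + r₂) + r₂ = d`.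
theorem card_infinitePlace_sum_isComplex :
    Fintype.card (InfinitePlace K ⊕ {w : InfinitePlace K // IsComplex w})
      = Module.finrank ℚ K := by
  have h := card_add_two_mul_card_eq_rank K
  have h' := card_eq_nrRealPlaces_add_nrComplexPlaces K
  rw [Fintype.card_sum, h']
  have : Fintype.card {w : InfinitePlace K // IsComplex w} = nrComplexPlaces K :=
    Fintype.card_congr (Equiv.refl _)
  omega

open scoped Classical in
open Pointwise in
theorem exists_finset_cover_smul_frontier_normLeOne (K : Type*) [Field K] [NumberField K] :
    ∃ C R : ℝ, ∀ r : ℝ, 1 ≤ r → ∃ T : Finset (mixedSpace K),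
      T.card ≤ C * r ^ (Module.finrank ℚ K - 1) ∧
      ∀ y ∈ r • frontier (normLeOne K), ∃ t ∈ T, dist y t ≤ R := by
  rw [← card_infinitePlace_sum_isComplex (K := K)]
  exact exists_finset_cover_smul_of_subset_cube_boundary mixedSpaceParam
    (fun s ↦ (contDiff_mixedSpaceParam s).contDiffOn.exists_lipschitzOnWith one_ne_zero
      (convex_Icc 0 1) isCompact_Icc)
    fun x hx ↦ exists_mixedSpaceParam_of_mem_frontier_normLeOne hx

end Frontier

/-! ### Counting ideals class by class -/

section IdealCount

open NumberField NumberField.InfinitePlace NumberField.mixedEmbedding Module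
  NumberField.mixedEmbedding.fundamentalCone NumberField.Units MeasureTheory
open scoped nonZeroDivisors Pointwise

variable (K : Type*) [Field K] [NumberField K]

theorem smul_normLeOne {r : ℝ} (hr : 0 < r) :
    r • normLeOne K = {x | x ∈ fundamentalCone K ∧ mixedEmbedding.norm x ≤ r ^ finrank ℚ K} := by
  ext x
  rw [Set.mem_smul_set_iff_inv_smul_mem₀ hr.ne', mem_normLeOne,
    smul_mem_iff_mem (inv_ne_zero hr.ne'), mixedEmbedding.norm_smul, abs_of_pos (inv_pos.mpr hr),
    inv_pow, inv_mul_le_iff₀ (pow_pos hr _), mul_one, Set.mem_ofPred_eq]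

open scoped Classical in
/-- The number of points of norm at most `s` of an ideal lattice in the fundamental cone is
`c * s + O(s ^ (1 - 1 / d))`. -/
theorem exists_abs_card_idealSet_norm_le_sub_le (J : (Ideal (𝓞 K))⁰) :
    ∃ c C : ℝ, ∀ s : ℝ, 1 ≤ s →
      |Nat.card {a : idealSet K J // mixedEmbedding.norm (a : mixedSpace K) ≤ s} - c * s|
        ≤ C * s ^ (1 - 1 / (finrank ℚ K : ℝ)) := by
  set d := finrank ℚ K
  have hd : 0 < d := finrank_pos
  have hd' : (d : ℝ) ≠ 0 := Nat.cast_ne_zero.mpr hd.ne'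
  set L := idealLattice K (FractionalIdeal.mk0 K J)
  set V := ZLattice.covolume L volume
  have hV : 0 < V := ZLattice.covolume_pos L volume
  obtain ⟨δ, hδ⟩ := ZLattice.exists_abs_card_mul_covolume_sub_le L volume
  obtain ⟨A, R, hAR⟩ := exists_finset_cover_smul_frontier_normLeOne K
  set B := (volume : Measure (mixedSpace K)).real (Metric.closedBall 0 (δ + R))
  refine ⟨(volume : Measure (mixedSpace K)).real (normLeOne K) / V, A * B / V, fun s hs ↦ ?_⟩
  have hs0 : 0 < s := by linarith
  set r := s ^ (1 / (d : ℝ)) with hr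
  have hr1 : 1 ≤ r := Real.one_le_rpow hs (by positivity)
  have hr0 : 0 < r := by linarith
  have hrd : r ^ d = s := by
    rw [hr, ← Real.rpow_mul_natCast hs0.le, one_div_mul_cancel hd', Real.rpow_one]
  have hrd' : r ^ (d - 1) = s ^ (1 - 1 / (d : ℝ)) := by
    rw [hr, ← Real.rpow_mul_natCast hs0.le, Nat.cast_sub hd]
    congr 1
    field_simp
    simp
  obtain ⟨T, hTcard, hT⟩ := hAR r hr1
  have hfr : frontier (r • normLeOne K) = r • frontier (normLeOne K) :=
    ((Homeomorph.smulOfNeZero r hr0.ne').image_frontier _).symm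
  have hmain := hδ (r • normLeOne K) ((measurableSet_normLeOne K).const_smul₀ r)
    ((isBounded_normLeOne K).smul₀ r) T R (by rwa [hfr])
  have hcard : Nat.card {a : idealSet K J // mixedEmbedding.norm (a : mixedSpace K) ≤ s}
      = Nat.card ((r • normLeOne K) ∩ L : Set (mixedSpace K)) := by
    refine Nat.card_congr ((Equiv.subtypeSubtypeEquivSubtypeInter (· ∈ idealSet K J)
      (mixedEmbedding.norm · ≤ s)).trans (Equiv.subtypeEquivProp (funext fun x ↦ propext ?_)))
    rw [smul_normLeOne K hr0, hrd]
    simp only [idealSet, Set.mem_inter_iff, Set.mem_ofPred_eq]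
    tauto
  have hvol : (volume : Measure (mixedSpace K)).real (r • normLeOne K)
      = s * (volume : Measure (mixedSpace K)).real (normLeOne K) := by
    rw [measureReal_def, Measure.addHaar_smul, mixedEmbedding.finrank, ENNReal.toReal_mul,
      ENNReal.toReal_ofReal (abs_nonneg _), abs_of_pos (pow_pos hr0 _), hrd, measureReal_def]
  rw [← hcard, hvol] at hmain
  rw [← mul_le_mul_iff_left₀ hV]
  calc _ = |Nat.card {a : idealSet K J // mixedEmbedding.norm (a : mixedSpace K) ≤ s} * V
        - s * (volume : Measure (mixedSpace K)).real (normLeOne K)| := by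
        nth_rw 2 [← abs_of_pos hV]
        rw [← abs_mul]
        congr 1
        field_simp
    _ ≤ T.card * B := hmain
    _ ≤ A * r ^ (d - 1) * B := by gcongr
    _ = _ := by rw [hrd']; field_simp

variable {K} in
-- `I ↦ J * I` makes the ideals principal and multiplies norms by that of `J`. Each such ideal has
-- `torsionOrder K` generators in the cone.
theorem card_mk0_eq_mul_torsionOrder {C : ClassGroup (𝓞 K)} {J : (Ideal (𝓞 K))⁰}
    (hJ : ClassGroup.mk0 J = C⁻¹) (s : ℝ) :
    Nat.card {I : (Ideal (𝓞 K))⁰ // Ideal.absNorm (I : Ideal (𝓞 K)) ≤ s ∧ ClassGroup.mk0 I = C}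
        * torsionOrder K
      = Nat.card {a : idealSet K J //
          mixedEmbedding.norm (a : mixedSpace K) ≤ s * Ideal.absNorm (J : Ideal (𝓞 K))} := by
  rw [← card_isPrincipal_dvd_norm_le]
  congr 1
  simp_rw [← nonZeroDivisors_dvd_iff_dvd_coe]
  refine Nat.card_congr ?_
  refine ((Equiv.dvd J).subtypeEquiv fun I ↦ ?_).trans
    (Equiv.subtypeSubtypeEquivSubtypeInter (fun I : (Ideal (𝓞 K))⁰ ↦ J ∣ I) _)
  rw [← ClassGroup.mk0_eq_one_iff (SetLike.coe_mem _)]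
  simp_rw [Equiv.dvd_apply, Submonoid.coe_mul, ← Submonoid.mul_def, _root_.map_mul, hJ,
    inv_mul_eq_one, Nat.cast_mul, mul_comm s, eq_comm, and_comm, and_congr_left_iff]
  exact fun _ ↦
    (mul_le_mul_iff_of_pos_left (Nat.cast_pos.mpr (Ideal.absNorm_pos_of_nonZeroDivisors J))).symm

theorem exists_abs_card_mk0_eq_sub_le (Cl : ClassGroup (𝓞 K)) :
    ∃ c C : ℝ, ∀ s : ℝ, 1 ≤ s →
      |Nat.card {I : (Ideal (𝓞 K))⁰ //
          Ideal.absNorm (I : Ideal (𝓞 K)) ≤ s ∧ ClassGroup.mk0 I = Cl} - c * s|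
        ≤ C * s ^ (1 - 1 / (finrank ℚ K : ℝ)) := by
  obtain ⟨J, hJ⟩ := ClassGroup.mk0_surjective Cl⁻¹
  obtain ⟨c, C, h⟩ := exists_abs_card_idealSet_norm_le_sub_le K J
  set N : ℝ := ((Ideal.absNorm (J : Ideal (𝓞 K)) : ℕ) : ℝ)
  have hN : 1 ≤ N := Nat.one_le_cast.mpr (Ideal.absNorm_pos_of_nonZeroDivisors J)
  set w : ℝ := (torsionOrder K : ℝ)
  have hw : 0 < w := Nat.cast_pos.mpr (torsionOrder_pos K)
  refine ⟨c * N / w, C * N ^ (1 - 1 / (finrank ℚ K : ℝ)) / w, fun s hs ↦ ?_⟩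
  have h' := h (s * N) (one_le_mul_of_one_le_of_one_le hs hN)
  rw [← card_mk0_eq_mul_torsionOrder hJ, Real.mul_rpow (by linarith) (by linarith),
    Nat.cast_mul] at h'
  rw [← mul_le_mul_iff_left₀ hw]
  nth_rw 2 [← abs_of_pos hw]
  rw [← abs_mul]
  calc _ = |_ * w - c * (s * N)| := by
        congr 1
        field_simp
    _ ≤ C * (s ^ (1 - 1 / (finrank ℚ K : ℝ)) * N ^ (1 - 1 / (finrank ℚ K : ℝ))) := h'
    _ = _ := by field_simp

/-- The number of nonzero ideals of norm at most `x` is `c_K * x + O(x ^ (1 - 1 / d))`. -/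
theorem exists_abs_card_idealsUpTo_sub_le :
    ∃ C : ℝ, ∀ x : ℝ, 1 ≤ x →
      |((idealsUpTo K x).card : ℝ) - idealDensity K * x|
        ≤ C * x ^ (1 - 1 / (finrank ℚ K : ℝ)) := by
  choose c C hC using exists_abs_card_mk0_eq_sub_le K
  have hcard : ∀ x : ℝ, (idealsUpTo K x).card = ∑ Cl : ClassGroup (𝓞 K),
      Nat.card {I : (Ideal (𝓞 K))⁰ //
        Ideal.absNorm (I : Ideal (𝓞 K)) ≤ x ∧ ClassGroup.mk0 I = Cl} := fun x ↦ by
    let e : idealsUpTo K x ≃ {I : (Ideal (𝓞 K))⁰ // (Ideal.absNorm (I : Ideal (𝓞 K)) : ℝ) ≤ x} :=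
      { toFun := fun I ↦ ⟨⟨I.1, mem_nonZeroDivisors_of_ne_zero (mem_idealsUpTo.1 I.2).1⟩,
          (mem_idealsUpTo.1 I.2).2⟩
        invFun := fun I ↦ ⟨I.1.1, mem_idealsUpTo.2 ⟨nonZeroDivisors.ne_zero I.1.2, I.2⟩⟩ }
    have : Finite {I : (Ideal (𝓞 K))⁰ // (Ideal.absNorm (I : Ideal (𝓞 K)) : ℝ) ≤ x} :=
      Finite.of_equiv _ e
    rw [← Nat.card_eq_finsetCard, Nat.card_congr e,
      Nat.card_congr (Equiv.sigmaFiberEquiv fun I :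
        {I : (Ideal (𝓞 K))⁰ // (Ideal.absNorm (I : Ideal (𝓞 K)) : ℝ) ≤ x} ↦
          ClassGroup.mk0 I.1).symm, Nat.card_sigma]
    exact Finset.sum_congr rfl fun Cl _ ↦ Nat.card_congr
      (Equiv.subtypeSubtypeEquivSubtypeInter
        (fun I : (Ideal (𝓞 K))⁰ ↦ (Ideal.absNorm (I : Ideal (𝓞 K)) : ℝ) ≤ x)
        fun I ↦ ClassGroup.mk0 I = Cl)
  have hbound : ∀ x : ℝ, 1 ≤ x → |((idealsUpTo K x).card : ℝ) - (∑ Cl, c Cl) * x|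
      ≤ (∑ Cl, C Cl) * x ^ (1 - 1 / (finrank ℚ K : ℝ)) := fun x hx ↦ by
    rw [hcard, Nat.cast_sum, Finset.sum_mul, Finset.sum_mul, ← Finset.sum_sub_distrib]
    exact (Finset.abs_sum_le_sum_abs _ _).trans (Finset.sum_le_sum fun Cl _ ↦ hC Cl x hx)
  have hd : 0 < 1 / (finrank ℚ K : ℝ) := one_div_pos.mpr (Nat.cast_pos.mpr finrank_pos)
  -- The class constants `c Cl` need no evaluation: uniqueness of the limit identifies their sum
  -- with `idealDensity K`.
  have hlim : Filter.Tendsto (fun x : ℝ ↦ ((idealsUpTo K x).card : ℝ) / x) Filter.atTop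
      (𝓝 (∑ Cl, c Cl)) := by
    rw [tendsto_iff_norm_sub_tendsto_zero]
    have h0 : Filter.Tendsto (fun x : ℝ ↦ (∑ Cl, C Cl) * x ^ (-(1 / (finrank ℚ K : ℝ))))
        Filter.atTop (𝓝 0) := by
      simpa using (tendsto_rpow_neg_atTop hd).const_mul (∑ Cl, C Cl)
    refine squeeze_zero' (Filter.Eventually.of_forall fun _ ↦ norm_nonneg _) ?_ h0
    filter_upwards [Filter.eventually_ge_atTop 1] with x hx
    have hx0 : 0 < x := by linarith
    have := hbound x hx
    rw [Real.norm_eq_abs, div_sub' hx0.ne', abs_div, abs_of_pos hx0, div_le_iff₀ hx0, mul_assoc,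
      ← Real.rpow_add_one hx0.ne', mul_comm x, neg_add_eq_sub]
    exact this
  refine ⟨∑ Cl, C Cl, fun x hx ↦ ?_⟩
  rw [tendsto_nhds_unique (tendsto_idealDensity K) hlim]
  exact hbound x hx

end IdealCount

/-! ### Abel summation -/

section AbelSummation

open MeasureTheory Set intervalIntegral

variable {g : ℝ → ℂ}

theorem continuousOn_derivWithin_Ici (hg : ContDiffOn ℝ 1 g (Ici 1)) :
    ContinuousOn (derivWithin g (Ici 1)) (Ici 1) :=
  hg.continuousOn_derivWithin (uniqueDiffOn_Ici 1) le_rfl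

theorem integral_derivWithin_Ici (hg : ContDiffOn ℝ 1 g (Ici 1)) {a x : ℝ} (ha : 1 ≤ a)
    (hax : a ≤ x) : ∫ t in a..x, derivWithin g (Ici 1) t = g x - g a := by
  refine integral_eq_sub_of_hasDerivAt_of_le hax
    (hg.continuousOn.mono (Icc_subset_Ici_self.trans (Ici_subset_Ici.mpr ha))) (fun t ht ↦ ?_) ?_
  · have ht1 : 1 < t := ha.trans_lt ht.1
    rw [derivWithin_of_mem_nhds (Ici_mem_nhds ht1)]
    exact ((hg.differentiableOn one_ne_zero t ht1.le).differentiableAt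
      (Ici_mem_nhds ht1)).hasDerivAt
  · refine ((continuousOn_derivWithin_Ici hg).mono ?_).intervalIntegrable
    rw [uIcc_of_le hax]
    exact Icc_subset_Ici_self.trans (Ici_subset_Ici.mpr ha)

theorem intervalIntegrable_derivWithin_Ici (hg : ContDiffOn ℝ 1 g (Ici 1)) {x : ℝ} (hx : 1 ≤ x) :
    IntervalIntegrable (derivWithin g (Ici 1)) volume 1 x := by
  refine ((continuousOn_derivWithin_Ici hg).mono ?_).intervalIntegrable
  rw [uIcc_of_le hx]
  exact Icc_subset_Ici_self

/-- Abel summation for a sum over a finite family of real numbers `N i ∈ [1, x]`. -/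
theorem sum_eq_card_mul_sub_integral {ι : Type*} (s : Finset ι) (N : ι → ℝ)
    (hg : ContDiffOn ℝ 1 g (Ici 1)) {x : ℝ} (hx : 1 ≤ x) (hN : ∀ i ∈ s, 1 ≤ N i ∧ N i ≤ x) :
    IntervalIntegrable (fun t ↦ ((s.filter fun i ↦ N i ≤ t).card : ℂ) * derivWithin g (Ici 1) t)
        volume 1 x ∧
      ∑ i ∈ s, g (N i) = s.card * g x
        - ∫ t in (1 : ℝ)..x, ((s.filter fun i ↦ N i ≤ t).card : ℂ) * derivWithin g (Ici 1) t := by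
  set g' := derivWithin g (Ici 1)
  have hg' := intervalIntegrable_derivWithin_Ici hg hx
  have hind : ∀ i, IntervalIntegrable ((Ici (N i)).indicator g') volume 1 x := fun i ↦
    ⟨hg'.1.indicator measurableSet_Ici, hg'.2.indicator measurableSet_Ici⟩
  have hfun : (fun t ↦ ((s.filter fun i ↦ N i ≤ t).card : ℂ) * g' t)
      = fun t ↦ ∑ i ∈ s, (Ici (N i)).indicator g' t := by
    ext t
    rw [Finset.card_filter, Nat.cast_sum, Finset.sum_mul]
    refine Finset.sum_congr rfl fun i _ ↦ ?_
    by_cases h : N i ≤ t <;> simp [indicator, h]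
  rw [hfun]
  refine ⟨by simpa only [Finset.sum_fn] using IntervalIntegrable.sum s fun i _ ↦ hind i, ?_⟩
  -- Termwise this is `g (N i) = g x - ∫ g'` over `[N i, x]`.
  rw [integral_finsetSum fun i _ ↦ hind i, eq_sub_iff_add_eq, ← Finset.sum_add_distrib,
    ← nsmul_eq_mul, ← Finset.sum_const]
  refine Finset.sum_congr rfl fun i hi ↦ ?_
  obtain ⟨h1, h2⟩ := hN i hi
  have : ∫ t in (1 : ℝ)..x, (Ici (N i)).indicator g' t = ∫ t in (N i)..x, g' t := by
    rw [integral_of_le hx, integral_of_le h2, setIntegral_indicator measurableSet_Ici]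
    refine setIntegral_congr_set ?_
    have hset : Ioc 1 x ∩ Ioi (N i) = Ioc (N i) x := by
      rw [Ioc_inter_Ioi, max_eq_right h1]
    exact hset ▸ (Filter.EventuallyEq.rfl.inter Ioi_ae_eq_Ici.symm)
  rw [this, integral_derivWithin_Ici hg h1 h2]
  ring

/-- Abel summation with an error term: if the counting function of the `N i` is `c * t + O(h t)`,
then the sum of the `g (N i)` is approximated by `c * (∫ g + g 1)`. -/
theorem norm_sum_sub_le_of_abs_card_sub_le {ι : Type*} (s : Finset ι) (N : ι → ℝ) {c C : ℝ}
    {h : ℝ → ℝ} (hh : ContinuousOn h (Ici 1)) (hg : ContDiffOn ℝ 1 g (Ici 1)) {x : ℝ} (hx : 1 ≤ x)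
    (hN : ∀ i ∈ s, 1 ≤ N i ∧ N i ≤ x)
    (hC : ∀ t, 1 ≤ t → t ≤ x → |((s.filter fun i ↦ N i ≤ t).card : ℝ) - c * t| ≤ C * h t) :
    ‖(∑ i ∈ s, g (N i)) - ((c : ℂ) * (∫ t in (1 : ℝ)..x, g t) + (c : ℂ) * g 1)‖
      ≤ C * (‖g x‖ * h x + ∫ t in (1 : ℝ)..x, ‖derivWithin g (Ici 1) t‖ * h t) := by
  obtain ⟨hint, hsum⟩ := sum_eq_card_mul_sub_integral s N hg hx hN
  set g' := derivWithin g (Ici 1)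
  have hsub : uIcc 1 x ⊆ Ici 1 := by
    rw [uIcc_of_le hx]; exact Icc_subset_Ici_self
  have hg' := intervalIntegrable_derivWithin_Ici hg hx
  -- The boundary term `g 1` here is the source of `c * g 1` in the main term.
  have hparts : ∫ t in (1 : ℝ)..x, (t : ℂ) * g' t = x * g x - g 1 - ∫ t in (1 : ℝ)..x, g t := by
    have := integral_mul_deriv_eq_deriv_mul_of_hasDeriv_right (a := 1) (b := x)
      (u := fun t : ℝ ↦ (t : ℂ)) (v := g) (u' := fun _ ↦ 1) (v' := g')
      (by fun_prop) (hg.continuousOn.mono hsub)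
      (fun t _ ↦ (Complex.ofRealCLM.hasDerivAt (x := t)).hasDerivWithinAt) (fun t ht ↦ ?_)
      (by simp) hg'
    · simpa using this
    · rw [min_eq_left hx, max_eq_right hx] at ht
      exact ((hg.differentiableOn one_ne_zero t ht.1.le).hasDerivWithinAt).mono
        (Ioi_subset_Ici ht.1.le)
  have hint' : IntervalIntegrable (fun t : ℝ ↦ (c : ℂ) * ((t : ℂ) * g' t)) volume 1 x :=
    (hg'.continuousOn_mul (by fun_prop)).const_mul _
  have hcard : (s.filter fun i ↦ N i ≤ x).card = s.card := by
    rw [Finset.filter_true_of_mem fun i hi ↦ (hN i hi).2]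
  have key : (∑ i ∈ s, g (N i)) - ((c : ℂ) * (∫ t in (1 : ℝ)..x, g t) + (c : ℂ) * g 1)
      = ((s.card : ℂ) - c * x) * g x
        - ∫ t in (1 : ℝ)..x, (((s.filter fun i ↦ N i ≤ t).card : ℂ) - c * t) * g' t := by
    have : ∀ t : ℝ, (((s.filter fun i ↦ N i ≤ t).card : ℂ) - c * t) * g' t
        = ((s.filter fun i ↦ N i ≤ t).card : ℂ) * g' t - c * (t * g' t) := fun t ↦ by ring
    simp_rw [this]
    rw [integral_sub hint hint', intervalIntegral.integral_const_mul, hparts, hsum]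
    ring
  have hnorm : ∀ n : ℕ, ∀ t : ℝ, ‖(n : ℂ) - c * t‖ = |(n : ℝ) - c * t| := fun n t ↦ by
    rw [← Real.norm_eq_abs, ← Complex.norm_real]; push_cast; rfl
  rw [key, mul_add, ← intervalIntegral.integral_const_mul]
  refine (norm_sub_le _ _).trans (add_le_add ?_ ?_)
  · rw [norm_mul, hnorm, mul_comm ‖g x‖, ← mul_assoc]
    exact mul_le_mul_of_nonneg_right (hcard ▸ hC x hx le_rfl) (norm_nonneg _)
  · refine norm_integral_le_of_norm_le hx (Filter.Eventually.of_forall fun t ht ↦ ?_) ?_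
    · rw [norm_mul, hnorm, mul_comm ‖g' t‖, ← mul_assoc]
      exact mul_le_mul_of_nonneg_right (hC t ht.1.le ht.2) (norm_nonneg _)
    · exact ((hg'.norm.mul_continuousOn (hh.mono hsub))).const_mul C

end AbelSummation

theorem mainTheorem9 (K : Type*) [Field K] [NumberField K] :
    ∃ C : ℝ, ∀ g : ℝ → ℂ, ContDiffOn ℝ 1 g (Set.Ici 1) → ∀ x : ℝ, 1 ≤ x →
      ‖(∑ m ∈ idealsUpTo K x, g (Ideal.absNorm m : ℝ))
          - ((idealDensity K : ℂ) * (∫ t in (1 : ℝ)..x, g t) + (idealDensity K : ℂ) * g 1)‖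
        ≤ C * (‖g x‖ * x ^ (1 - 1 / (Module.finrank ℚ K : ℝ))
          + ∫ t in (1 : ℝ)..x, ‖derivWithin g (Set.Ici 1) t‖
              * t ^ (1 - 1 / (Module.finrank ℚ K : ℝ))) := by
  classical
  obtain ⟨C, hC⟩ := exists_abs_card_idealsUpTo_sub_le K
  refine ⟨C, fun g hg x hx ↦ norm_sum_sub_le_of_abs_card_sub_le (idealsUpTo K x)
    (fun m ↦ (Ideal.absNorm m : ℝ)) (h := fun t ↦ t ^ (1 - 1 / (Module.finrank ℚ K : ℝ)))
    ?_ hg hx (fun m hm ↦ ?_) fun t ht htx ↦ ?_⟩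
  · exact fun t ht ↦ (Real.continuousAt_rpow_const t _
      (.inl (zero_lt_one.trans_le ht).ne')).continuousWithinAt
  · rw [mem_idealsUpTo] at hm
    exact ⟨Nat.one_le_cast.mpr (Nat.one_le_iff_ne_zero.mpr
      (Ideal.absNorm_eq_zero_iff.not.mpr hm.1)), hm.2⟩
  -- For `t ≤ x`, truncation at `x` does not affect the count at `t`.
  · have : (idealsUpTo K x).filter (fun m ↦ (Ideal.absNorm m : ℝ) ≤ t) = idealsUpTo K t := by
      ext m
      simp only [Finset.mem_filter, mem_idealsUpTo]
      exact ⟨fun h ↦ ⟨h.1.1, h.2⟩, fun h ↦ ⟨⟨h.1, h.2.trans htx⟩, h.2⟩⟩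
    rw [this]
    exact hC t ht
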